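/- Let $d\in\mathbb{N}=\{1,2,\dots\}$, $p\in\{2,4,6,\dots\}$, $\alpha,\kappa,c\in(0,\infty)$, $\nu\in(0,1)$, $\xi,\vartheta\in\mathbb{R}^d$, let $\langle\cdot,\cdot\rangle\colon\mathbb{R}^d\times\mathbb{R}^d\to\mathbb{R}$ be a scalar product (not necessarily the Euclidean one), let $\|\theta\|=\sqrt{\langle\theta,\theta\rangle}$, let $(\Omega,\mathcal{F},\mathbb{P})$ be a probability space, let $(S,\mathcal{S})$ be a measurable space, and let $X_n\colon\Omega\to S$, $n\in\mathbb{N}$, be i.i.d. random variables. (a) Let $G\colon\mathbb{R}^d\times S\to\mathbb{R}^d$ be $(\mathcal{B}(\mathbb{R}^d)\otimes\mathcal{S})/\mathcal{B}(\mathbb{R}^d)$-measurable, let $g\colon\mathbb{R}^d\to\mathbb{R}^d$, assume for all $\theta\in\mathbb{R}^d$ that $$\mathbb{E}\big[\|G(\theta,X_1)-g(\theta)\|^p\big]\le\kappa\,(1+\|\theta\|^p),\qquad g(\theta)=\mathbb{E}[G(\theta,X_1)],$$ $$\langle\theta-\vartheta,g(\theta)\rangle\le-c\max\{\|\theta-\vartheta\|^2,\|g(\theta)\|^2\},$$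 and let $\Theta\colon\mathbb{N}_0\times\Omega\to\mathbb{R}^d$ satisfy for all $n\in\mathbb{N}$ that $\Theta_0=\xi$ and $\Theta_n=\Theta_{n-1}+\frac{\alpha}{n^\nu}G(\Theta_{n-1},X_n)$. Then $\{\theta\in\mathbb{R}^d\colon g(\theta)=0\}=\{\vartheta\}$, and there exists $C\in(0,\infty)$ such that for all $n\in\mathbb{N}$ $$\big(\mathbb{E}[\|\Theta_n-\vartheta\|^p]\big)^{1/p}\le C\,n^{-\nu/2}.$$ (b) Let $F\colon\mathbb{R}^d\times S\to\mathbb{R}$ be $(\mathcal{B}(\mathbb{R}^d)\otimes\mathcal{S})/\mathcal{B}(\mathbb{R})$-measurable, assume that $\theta\mapsto F(\theta,x)$ is in $C^1(\mathbb{R}^d,\mathbb{R})$ for every $x\in S$, write $(\nabla_\theta F)(\theta,x)\in\mathbb{R}^d$ for the vector of partial derivatives of $F$ with respect to the coordinates of $\theta$, let $g\colon\mathbb{R}^d\to\mathbb{R}^d$, assume for all $\theta\in\mathbb{R}^d$ that $$\mathbb{E}\big[\|(\nabla_\theta F)(\theta,X_1)-g(\theta)\|^p\big]\le\kappa\,(1+\|\theta\|^p),\qquad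 g(\theta)=\mathbb{E}[(\nabla_\theta F)(\theta,X_1)],$$ $$\langle\theta-\vartheta,g(\theta)\rangle\le-c\max\{\|\theta-\vartheta\|^2,\|g(\theta)\|^2\},$$ and let $\Theta\colon\mathbb{N}_0\times\Omega\to\mathbb{R}^d$ satisfy for all $n\in\mathbb{N}$ that $\Theta_0=\xi$ and $\Theta_n=\Theta_{n-1}+\frac{\alpha}{n^\nu}(\nabla_\theta F)(\Theta_{n-1},X_n)$. Then $\{\theta\in\mathbb{R}^d\colon g(\theta)=0\}=\{\vartheta\}$, and there exists $C\in(0,\infty)$ such that $(\mathbb{E}[\|\Theta_n-\vartheta\|^p])^{1/p}\le C\,n^{-\nu/2}$ for all $n\in\mathbb{N}$. (c) Let $F$ be as in (b) (measurable, and $C^1$ in $\theta$), assume for all $\theta\in\mathbb{R}^d$ that $\mathbb{E}[\|(\nabla_\theta F)(\theta,X_1)\|]<\infty$, $$\big\langle\theta-\vartheta,\mathbb{E}[(\nabla_\theta F)(\theta,X_1)]\big\rangle\le-c\max\big\{\|\theta-\vartheta\|^2,\|\mathbb{E}[(\nabla_\theta F)(\theta,X_1)]\|^2\big\},$$ $$\mathbb{E}\big[\|(\nabla_\theta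 F)(\theta,X_1)-\mathbb{E}[(\nabla_\theta F)(\theta,X_1)]\|^p\big]\le\kappa\,(1+\|\theta\|^p),$$ and let $\Theta$ be as in (b). Then $\{\theta\in\mathbb{R}^d\colon\mathbb{E}[(\nabla_\theta F)(\theta,X_1)]=0\}=\{\vartheta\}$, and there exists $C\in(0,\infty)$ such that $(\mathbb{E}[\|\Theta_n-\vartheta\|^p])^{1/p}\le C\,n^{-\nu/2}$ for all $n\in\mathbb{N}$. -/

import Mathlib

open MeasureTheory ProbabilityTheory
open scoped ENNReal

namespace StochApprox

/-- The space `ℝ^d`, with its Borel sigma-algebra. -/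
abbrev Vec (d : ℕ) : Type := EuclideanSpace ℝ (Fin d)

/-- A bilinear form on `ℝ^d` is a scalar product if it is symmetric and positive definite. It need
not be the Euclidean one. -/
structure IsScalarProduct {d : ℕ} (B : LinearMap.BilinForm ℝ (Vec d)) : Prop where
  symm : ∀ v w : Vec d, B v w = B w v
  pos : ∀ v : Vec d, v ≠ 0 → 0 < B v v

/-- The norm `‖v‖ = √⟨v, v⟩` of a scalar product. -/
noncomputable def spNorm {d : ℕ} (B : LinearMap.BilinForm ℝ (Vec d)) (v : Vec d) : ℝ :=
  Real.sqrt (B v v)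

/-- The expectation, with values in `[0, ∞]`, of a non-negative real random variable. -/
noncomputable def expectNN {Ω : Type*} [MeasurableSpace Ω] (P : Measure Ω) (Y : Ω → ℝ) : ℝ≥0∞ :=
  ∫⁻ ω, ENNReal.ofReal (Y ω) ∂P

/-- The random variables `X 1, X 2, X 3, …` are independent and identically distributed
(`X 0` plays no role). -/
structure IsIID {Ω S : Type*} [MeasurableSpace Ω] [MeasurableSpace S] (P : Measure Ω)
    (X : ℕ → Ω → S) : Prop where
  measurable : ∀ n : ℕ, Measurable (X (n + 1))
  indep : iIndepFun (fun n : ℕ => X (n + 1)) P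
  identDistrib : ∀ n : ℕ, IdentDistrib (X (n + 1)) (X 1) P P

/-- `⟨θ - ϑ, g θ⟩ ≤ -c max {‖θ - ϑ‖², ‖g θ‖²}` for all `θ`. -/
def Coercive {d : ℕ} (B : LinearMap.BilinForm ℝ (Vec d)) (c : ℝ) (ϑ : Vec d)
    (g : Vec d → Vec d) : Prop :=
  ∀ θ : Vec d, B (θ - ϑ) (g θ) ≤ -c * max (spNorm B (θ - ϑ) ^ 2) (spNorm B (g θ) ^ 2)

/-- `E[‖G(θ, Y) - g θ‖^p] ≤ κ (1 + ‖θ‖^p)` for all `θ`. -/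
def NoiseBound {d : ℕ} {Ω S : Type*} [MeasurableSpace Ω] (P : Measure Ω)
    (B : LinearMap.BilinForm ℝ (Vec d)) (p : ℕ) (κ : ℝ) (G : Vec d → S → Vec d) (Y : Ω → S)
    (g : Vec d → Vec d) : Prop :=
  ∀ θ : Vec d, expectNN P (fun ω => spNorm B (G θ (Y ω) - g θ) ^ p) ≤
    ENNReal.ofReal (κ * (1 + spNorm B θ ^ p))

/-- `Θ_0 = ξ` and `Θ_n = Θ_{n-1} + (α / n^ν) G(Θ_{n-1}, X_n)` for all `n ≥ 1`. -/
def IsStochApprox {d : ℕ} {Ω S : Type*} (α ν : ℝ) (ξ : Vec d) (G : Vec d → S → Vec d)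
    (X : ℕ → Ω → S) (Θ : ℕ → Ω → Vec d) : Prop :=
  ∀ ω : Ω, Θ 0 ω = ξ ∧ ∀ n : ℕ, 1 ≤ n →
    Θ n ω = Θ (n - 1) ω + (α / (n : ℝ) ^ ν) • G (Θ (n - 1) ω) (X n ω)

/-- There is `C ∈ (0, ∞)` with `(E[‖Θ_n - ϑ‖^p])^{1/p} ≤ C n^{-ν/2}` for all `n ≥ 1`. -/
def HasStrongRate {d : ℕ} {Ω : Type*} [MeasurableSpace Ω] (P : Measure Ω)
    (B : LinearMap.BilinForm ℝ (Vec d)) (p : ℕ) (ν : ℝ) (ϑ : Vec d) (Θ : ℕ → Ω → Vec d) : Prop :=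
  ∃ C : ℝ, 0 < C ∧ ∀ n : ℕ, 1 ≤ n →
    expectNN P (fun ω => spNorm B (Θ n ω - ϑ) ^ p) ^ (1 / (p : ℝ)) ≤
      ENNReal.ofReal (C * (n : ℝ) ^ (-ν / 2))

/-- The gradient `(∇_θ F)(θ, x)`: the vector of the partial derivatives of `F` with respect to the
coordinates of `θ`. -/
noncomputable def gradTheta {d : ℕ} {S : Type*} (F : Vec d → S → ℝ) (θ : Vec d) (x : S) : Vec d :=
  gradient (fun η => F η x) θ

end StochApprox

/-! ### Real inequalities: expansion of even powers of the norm. -/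

namespace StochApprox

/-! Write `p = 2 * (q + 1)` and follow `u n = E[⟨Θ n - ϑ, Θ n - ϑ⟩ ^ (q + 1)]`. A step of size `γ`
from `θ` leads to the error `(θ - ϑ + γ g θ) + γ D`, where `D = G(θ, X) - g θ` is centred.
Coercivity contracts the drift part: its squared norm is at most `(1 - c γ) ‖θ - ϑ‖²` once `γ ≤ c`
(`Coercive.step_apply_self_le`). For the noise, expand the even power to second order: the linear
term has mean zero, and Young's inequality splits the rest into a small multiple of `γ` times the
leading power plus `C γ ^ (q + 2) E‖D‖^p` (`exists_lintegral_add_smul_le`). As `E‖D‖^p` grows at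
most like `1 + ‖θ - ϑ‖^p`, small steps give `u (n + 1) ≤ (1 - c γ / 2) u n + C γ ^ (q + 2)`, with `γ
= α (n + 1)^(-ν)`.

The equilibrium of this recursion is of order `γ ^ (q + 1)`. Since `ν < 1`, the relative change `1 /
n` of `γ` is negligible against the contraction `γ`, so `u n` stays of that order
(`exists_rate_of_recursion`), and the `p`-th root is of order `γ ^ (1 / 2)`. The finitely many early
steps, which may be large, need only keep `u n` finite.

The passage from a fixed `θ` to the random iterate uses that `Θ n` depends on `X 1, …, X n` alone,
hence is independent of `X (n + 1)`. -/

/-- Second-order expansion of `‖a + b‖ ^ (2 * (q + 1))`, with `x = ‖a‖ ^ 2`, `y = ⟨a, b⟩` and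
`z = ‖b‖ ^ 2`. -/
theorem exists_pow_expansion_bound (q : ℕ) : ∃ K : ℝ, 0 < K ∧ ∀ x y z : ℝ, 0 ≤ x → 0 ≤ z →
    y ^ 2 ≤ x * z → (x + 2 * y + z) ^ (q + 1) ≤
      x ^ (q + 1) + 2 * (q + 1) * x ^ q * y + K * (x ^ q * z + z ^ (q + 1)) := by
  induction q with
  | zero =>
    refine ⟨1, one_pos, fun x y z hx hz _ => ?_⟩
    norm_num
    linarith
  | succ q ih =>
    obtain ⟨K, hK, h⟩ := ih
    -- The induction hypothesis is multiplied by `x + 2 * y + z ≥ 0`. Mixed monomials are bounded by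
    -- `x ^ (q + 1) * z + z ^ (q + 2)` on comparing `x` with `z`; the collected coefficients are at
    -- most `6 * K + 6 * (q + 1) + 1`.
    refine ⟨8 * K + 8 * (q + 1), by positivity, fun x y z hx hz hy => ?_⟩
    have hyle : 2 * y ≤ x + z := by
      refine le_of_sq_le_sq ?_ (by positivity)
      nlinarith [sq_nonneg (x - z)]
    have hyge : -(2 * y) ≤ x + z := by
      refine le_of_sq_le_sq ?_ (by positivity)
      nlinarith [sq_nonneg (x - z)]
    have hs : 0 ≤ x + 2 * y + z := by linarith
    have hxq : 0 ≤ x ^ q := by positivity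
    have hzq : 0 ≤ z ^ q := by positivity
    have mixed1 : x ^ q * z ^ 2 ≤ x ^ (q + 1) * z + z ^ (q + 2) := by
      rcases le_total z x with hzx | hxz
      · have : x ^ q * z ^ 2 ≤ x ^ (q + 1) * z := by
          have := mul_le_mul_of_nonneg_left hzx (mul_nonneg hxq hz)
          calc x ^ q * z ^ 2 = x ^ q * z * z := by ring
            _ ≤ x ^ q * z * x := this
            _ = _ := by ring
        have : 0 ≤ z ^ (q + 2) := by positivity
        linarith
      · have : x ^ q * z ^ 2 ≤ z ^ (q + 2) := by
          rw [pow_add]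
          gcongr
        have : 0 ≤ x ^ (q + 1) * z := by positivity
        linarith
    have mixed2 : x * z ^ (q + 1) ≤ x ^ (q + 1) * z + z ^ (q + 2) := by
      rcases le_total z x with hzx | hxz
      · have : x * z ^ (q + 1) ≤ x ^ (q + 1) * z := by
          have := mul_le_mul_of_nonneg_left (pow_le_pow_left₀ hz hzx q) (mul_nonneg hx hz)
          calc x * z ^ (q + 1) = x * z * z ^ q := by ring
            _ ≤ x * z * x ^ q := this
            _ = _ := by ring
        have : 0 ≤ z ^ (q + 2) := by positivity
        linarith
      · have : x * z ^ (q + 1) ≤ z ^ (q + 2) := by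
          calc x * z ^ (q + 1) ≤ z * z ^ (q + 1) := by gcongr
            _ = _ := by ring
        have : 0 ≤ x ^ (q + 1) * z := by positivity
        linarith
    have h1 := mul_le_mul_of_nonneg_right (h x y z hx hz hy) hs
    have h2 : x ^ q * y ^ 2 ≤ x ^ (q + 1) * z := by
      calc x ^ q * y ^ 2 ≤ x ^ q * (x * z) := by gcongr
        _ = _ := by ring
    have h3 : x ^ q * z * (2 * y) ≤ x ^ q * z * (x + z) := by gcongr
    have h4 : K * (x ^ q * z + z ^ (q + 1)) * (x + 2 * y + z) ≤
        K * (x ^ q * z + z ^ (q + 1)) * (2 * (x + z)) := by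
      gcongr
      linarith
    have hA : 0 ≤ x ^ (q + 1) * z := by positivity
    have hB : 0 ≤ z ^ (q + 2) := by positivity
    have hq : (0 : ℝ) ≤ q + 1 := by positivity
    have h2' := mul_le_mul_of_nonneg_left h2 hq
    have h3' := mul_le_mul_of_nonneg_left h3 hq
    have m1 := mul_le_mul_of_nonneg_left mixed1 hq
    have m2 := mul_le_mul_of_nonneg_left mixed1 hK.le
    have m3 := mul_le_mul_of_nonneg_left mixed2 hK.le
    have hqA := mul_nonneg hq hA
    have hqB := mul_nonneg hq hB
    have hKA := mul_nonneg hK.le hA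
    have hKB := mul_nonneg hK.le hB
    push_cast
    have e1 : (x + 2 * y + z) ^ (q + 1 + 1) = (x + 2 * y + z) ^ (q + 1) * (x + 2 * y + z) :=
      pow_succ _ _
    rw [e1]
    refine h1.trans ?_
    have e2 : (x ^ (q + 1) + 2 * (q + 1) * x ^ q * y + K * (x ^ q * z + z ^ (q + 1))) *
        (x + 2 * y + z) = x ^ (q + 1 + 1) + 2 * (q + 1 + 1) * x ^ (q + 1) * y
        + (x ^ (q + 1) * z + 4 * ((q + 1) * (x ^ q * y ^ 2)) + (q + 1) * (x ^ q * z * (2 * y)))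
        + K * (x ^ q * z + z ^ (q + 1)) * (x + 2 * y + z) := by ring
    have e3 : K * (x ^ q * z + z ^ (q + 1)) * (2 * (x + z)) =
      2 * (K * (x ^ (q + 1) * z)) + 2 * (K * (x ^ q * z ^ 2)) + 2 * (K * (x * z ^ (q + 1)))
        + 2 * (K * z ^ (q + 2)) := by ring
    have e4 : ((q : ℝ) + 1) * (x ^ q * z * (x + z)) = (q + 1) * (x ^ (q + 1) * z) +
      (q + 1) * (x ^ q * z ^ 2) := by ring
    have e5 : (8 * K + 8 * ((q : ℝ) + 1)) * (x ^ (q + 1) * z + z ^ (q + 1 + 1)) =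
      8 * (K * (x ^ (q + 1) * z)) + 8 * (K * z ^ (q + 2)) + 8 * ((q + 1) * (x ^ (q + 1) * z)) +
      8 * ((q + 1) * z ^ (q + 2)) := by ring
    rw [e2, e5]
    rw [e3] at h4
    rw [e4] at h3'
    nlinarith

theorem mul_pow_mul_le_young (q : ℕ) {K ε x w : ℝ} (hK : 0 < K) (hε : 0 < ε) (hx : 0 ≤ x)
    (hw : 0 ≤ w) :
    K * (x ^ q * w) ≤ ε * x ^ (q + 1) + K * (K / ε) ^ q * w ^ (q + 1) := by
  rcases le_total (K * w) (ε * x) with h | h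
  · have h1 : K * (x ^ q * w) ≤ ε * x ^ (q + 1) := by
      calc K * (x ^ q * w) = x ^ q * (K * w) := by ring
        _ ≤ x ^ q * (ε * x) := by gcongr
        _ = _ := by ring
    have : 0 ≤ K * (K / ε) ^ q * w ^ (q + 1) := by positivity
    linarith
  · have hxw : x ≤ K / ε * w := by
      rw [div_mul_eq_mul_div, le_div_iff₀ hε]
      linarith
    have h1 : K * (x ^ q * w) ≤ K * (K / ε) ^ q * w ^ (q + 1) := by
      calc K * (x ^ q * w) ≤ K * ((K / ε * w) ^ q * w) := by gcongr
        _ = _ := by ring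
    have : 0 ≤ ε * x ^ (q + 1) := by positivity
    linarith

/-- The expansion of `‖a + γ • D‖ ^ (2 * (q + 1))`, with the quadratic part absorbed into the
leading and the last term. -/
theorem exists_pow_expansion_bound_of_step (q : ℕ) {ε : ℝ} (hε : 0 < ε) :
    ∃ C : ℝ, 0 < C ∧ ∀ γ x y z : ℝ, 0 < γ → γ ≤ 1 → 0 ≤ x → 0 ≤ z → y ^ 2 ≤ x * z →
      (x + 2 * (γ * y) + γ ^ 2 * z) ^ (q + 1) ≤
        (1 + ε * γ) * x ^ (q + 1) + 2 * (q + 1) * x ^ q * γ * y + C * γ ^ (q + 2) * z ^ (q + 1) := by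
  obtain ⟨K, hK, h⟩ := exists_pow_expansion_bound q
  refine ⟨K * (K / ε) ^ q + K, by positivity, fun γ x y z hγ hγ1 hx hz hy => ?_⟩
  have h1 := h x (γ * y) (γ ^ 2 * z) hx (by positivity) (by
    calc (γ * y) ^ 2 = γ ^ 2 * y ^ 2 := by ring
      _ ≤ γ ^ 2 * (x * z) := by gcongr
      _ = _ := by ring)
  -- Of the two factors `γ`, one stays outside Young's inequality and one goes into `w = γ * z`;
  -- this produces both `ε * γ` and `γ ^ (q + 2)`.
  have h2 := mul_le_mul_of_nonneg_left
    (mul_pow_mul_le_young q hK hε hx (mul_nonneg hγ.le hz)) hγ.le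
  have h3 : (γ ^ 2) ^ (q + 1) ≤ γ ^ (q + 2) := by
    rw [← pow_mul]
    exact pow_le_pow_of_le_one hγ.le hγ1 (by omega)
  have h4 : K * z ^ (q + 1) * (γ ^ 2) ^ (q + 1) ≤ K * z ^ (q + 1) * γ ^ (q + 2) := by gcongr
  calc _ ≤ _ := h1
    _ = x ^ (q + 1) + 2 * (q + 1) * x ^ q * γ * y + γ * (K * (x ^ q * (γ * z)))
        + K * z ^ (q + 1) * (γ ^ 2) ^ (q + 1) := by ring
    _ ≤ x ^ (q + 1) + 2 * (q + 1) * x ^ q * γ * y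
        + γ * (ε * x ^ (q + 1) + K * (K / ε) ^ q * (γ * z) ^ (q + 1))
        + K * z ^ (q + 1) * γ ^ (q + 2) := by linarith
    _ = _ := by ring

/-! ### The scalar recursion with slowly decreasing weights. -/

theorem one_add_pow_le (q : ℕ) {t : ℝ} (ht0 : 0 ≤ t) (ht1 : t ≤ 1) :
    (1 + t) ^ q ≤ 1 + (2 ^ q - 1) * t := by
  induction q with
  | zero => simp
  | succ q ih =>
    have h2 : (1 : ℝ) ≤ 2 ^ q := one_le_pow₀ (by norm_num)
    calc (1 + t) ^ (q + 1) = (1 + t) ^ q * (1 + t) := pow_succ _ _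
      _ ≤ (1 + (2 ^ q - 1) * t) * (1 + t) := by gcongr
      _ = 1 + 2 ^ q * t + (2 ^ q - 1) * (t * t) := by ring
      _ ≤ 1 + 2 ^ q * t + (2 ^ q - 1) * (t * 1) := by
        have : 0 ≤ (2 : ℝ) ^ q - 1 := by linarith
        gcongr
      _ = _ := by ring

/-- The weights `n ^ (-ν)` decrease slowly compared with their own size. -/
theorem eventually_rpow_neg_pow_mul_le (q : ℕ) {ν b : ℝ} (hν0 : 0 < ν) (hν1 : ν < 1) (hb : 0 < b) :
    ∃ N : ℕ, 1 ≤ N ∧ ∀ n : ℕ, N ≤ n → b * ((n + 1 : ℕ) : ℝ) ^ (-ν) ≤ 1 ∧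
      ((n : ℝ) ^ (-ν)) ^ q * (1 - b * ((n + 1 : ℕ) : ℝ) ^ (-ν)) ≤
        (((n + 1 : ℕ) : ℝ) ^ (-ν)) ^ q * (1 - b / 2 * ((n + 1 : ℕ) : ℝ) ^ (-ν)) := by
  have t1 : Filter.Tendsto (fun n : ℕ => (n : ℝ) ^ (1 - ν)) Filter.atTop Filter.atTop :=
    (tendsto_rpow_atTop (by linarith)).comp tendsto_natCast_atTop_atTop
  have t2 : Filter.Tendsto (fun n : ℕ => (n : ℝ) ^ ν) Filter.atTop Filter.atTop :=
    (tendsto_rpow_atTop hν0).comp tendsto_natCast_atTop_atTop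
  -- The first threshold, with `(n + 1) ^ ν ≤ 2 * n ^ ν`, gives `2 ^ q / n ≤ b / 2 * δ`, so half of
  -- the contraction pays for the change of weight; the second gives `b * δ ≤ 1`.
  obtain ⟨N, hN⟩ := Filter.eventually_atTop.1
    ((t1.eventually_ge_atTop (4 * 2 ^ q / b)).and (t2.eventually_ge_atTop b))
  refine ⟨max N 1, le_max_right _ _, fun n hn => ?_⟩
  obtain ⟨h1, h2⟩ := hN n ((le_max_left _ _).trans hn)
  have hn1 : 1 ≤ n := (le_max_right _ _).trans hn
  have hn0 : (0 : ℝ) < n := by exact_mod_cast hn1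
  have hn1' : (1 : ℝ) ≤ n := by exact_mod_cast hn1
  set δ : ℝ := ((n + 1 : ℕ) : ℝ) ^ (-ν) with hδ
  have hm0 : (0 : ℝ) < ((n + 1 : ℕ) : ℝ) := by positivity
  have hδ0 : 0 < δ := by positivity
  have hnm : (n : ℝ) ≤ ((n + 1 : ℕ) : ℝ) := by push_cast; linarith
  have hδinv : δ = (((n + 1 : ℕ) : ℝ) ^ ν)⁻¹ := Real.rpow_neg hm0.le ν
  have hbδ : b * δ ≤ 1 := by
    rw [hδinv, ← div_eq_mul_inv, div_le_one (by positivity)]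
    exact h2.trans (Real.rpow_le_rpow hn0.le hnm hν0.le)
  refine ⟨hbδ, ?_⟩
  have hratio : (n : ℝ) ^ (-ν) ≤ (1 + 1 / n) * δ := by
    have e : (n : ℝ) ^ (-ν) = (1 + 1 / (n : ℝ)) ^ ν * δ := by
      have : (1 + 1 / (n : ℝ)) = ((n + 1 : ℕ) : ℝ) / n := by
        push_cast; field_simp
      rw [this, Real.div_rpow hm0.le hn0.le, hδinv, Real.rpow_neg hn0.le]
      have := (Real.rpow_pos_of_pos hm0 ν).ne'
      field_simp
    rw [e]
    gcongr
    have h1le : (1 : ℝ) ≤ 1 + 1 / n := by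
      have : (0 : ℝ) ≤ 1 / n := by positivity
      linarith
    calc (1 + 1 / (n : ℝ)) ^ ν ≤ (1 + 1 / (n : ℝ)) ^ (1 : ℝ) :=
          Real.rpow_le_rpow_of_exponent_le h1le hν1.le
      _ = _ := Real.rpow_one _
  have hsmall : 2 ^ q * (1 / (n : ℝ)) ≤ b / 2 * δ := by
    have h3 : ((n + 1 : ℕ) : ℝ) ^ ν ≤ 2 * (n : ℝ) ^ ν := by
      calc ((n + 1 : ℕ) : ℝ) ^ ν ≤ (2 * (n : ℝ)) ^ ν := by
            apply Real.rpow_le_rpow hm0.le _ hν0.le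
            push_cast; linarith
        _ = 2 ^ ν * (n : ℝ) ^ ν := Real.mul_rpow (by norm_num) hn0.le
        _ ≤ 2 ^ (1 : ℝ) * (n : ℝ) ^ ν := by
            gcongr
            norm_num
        _ = _ := by rw [Real.rpow_one]
    have h4 : (n : ℝ) ^ (1 - ν) = n / (n : ℝ) ^ ν := by
      rw [Real.rpow_sub hn0, Real.rpow_one]
    rw [h4, div_le_div_iff₀ hb (by positivity)] at h1
    rw [hδinv, ← div_eq_mul_inv, mul_one_div, div_le_div_iff₀ hn0 (by positivity)]
    have h5 := mul_le_mul_of_nonneg_left h3 (show (0 : ℝ) ≤ 2 ^ q by positivity)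
    nlinarith
  have ht : (1 : ℝ) / n ≤ 1 := by
    rw [div_le_one hn0]; exact hn1'
  have hpow := one_add_pow_le q (t := 1 / (n : ℝ)) (by positivity) ht
  have hfac : (1 + 1 / (n : ℝ)) ^ q ≤ 1 + b / 2 * δ := by
    have : 0 ≤ 1 / (n : ℝ) := by positivity
    linarith
  have h6 : ((n : ℝ) ^ (-ν)) ^ q ≤ (1 + b / 2 * δ) * δ ^ q := by
    calc ((n : ℝ) ^ (-ν)) ^ q ≤ ((1 + 1 / n) * δ) ^ q := by gcongr
      _ = (1 + 1 / (n : ℝ)) ^ q * δ ^ q := mul_pow _ _ _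
      _ ≤ _ := by gcongr
  calc ((n : ℝ) ^ (-ν)) ^ q * (1 - b * δ) ≤ (1 + b / 2 * δ) * δ ^ q * (1 - b * δ) := by
        have : 0 ≤ 1 - b * δ := by linarith
        gcongr
    _ = δ ^ q * ((1 + b / 2 * δ) * (1 - b * δ)) := by ring
    _ ≤ _ := by
        gcongr
        nlinarith [mul_pos hb hδ0]

/-- A large multiple of the `q`-th power of the weights is a supersolution: half of the contraction
absorbs the change of the weights and the other half the source term. -/
theorem exists_rate_of_recursion (q : ℕ) {ν b C : ℝ} (hν0 : 0 < ν) (hν1 : ν < 1) (hb : 0 < b)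
    (hC : 0 ≤ C) {u : ℕ → ℝ} (hu : ∀ n, 0 ≤ u n) {N : ℕ}
    (hrec : ∀ n : ℕ, N ≤ n → u (n + 1) ≤ (1 - b * ((n + 1 : ℕ) : ℝ) ^ (-ν)) * u n +
      C * (((n + 1 : ℕ) : ℝ) ^ (-ν)) ^ (q + 1)) :
    ∃ M : ℝ, 0 < M ∧ ∀ n : ℕ, 1 ≤ n → u n ≤ M * ((n : ℝ) ^ (-ν)) ^ q := by
  obtain ⟨N₁, hN₁, h⟩ := eventually_rpow_neg_pow_mul_le q hν0 hν1 hb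
  set L := max N N₁
  -- In the bound `T + 2 * C / b + 1`, the sum `T` covers the indices up to `L`, `2 * C / b` absorbs
  -- the source, and `1` ensures positivity.
  set T := ∑ i ∈ Finset.range (L + 1), u i / ((i : ℝ) ^ (-ν)) ^ q
  have hterm : ∀ i : ℕ, 0 ≤ u i / ((i : ℝ) ^ (-ν)) ^ q := fun i => by
    have := hu i
    positivity
  have hT : 0 ≤ T := Finset.sum_nonneg fun i _ => hterm i
  have hM : 0 < T + 2 * C / b + 1 := by positivity
  have small : ∀ n : ℕ, 1 ≤ n → n ≤ L →
      u n ≤ (T + 2 * C / b + 1) * ((n : ℝ) ^ (-ν)) ^ q := by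
    intro n hn hnL
    have hn0 : (0 : ℝ) < n := by exact_mod_cast hn
    rw [← div_le_iff₀ (by positivity)]
    have : u n / ((n : ℝ) ^ (-ν)) ^ q ≤ T :=
      Finset.single_le_sum (f := fun i : ℕ => u i / ((i : ℝ) ^ (-ν)) ^ q)
        (fun i _ => hterm i) (Finset.mem_range.2 (by omega))
    have : 0 ≤ 2 * C / b := by positivity
    linarith
  refine ⟨_, hM, fun n hn => ?_⟩
  rcases le_total n L with hnL | hLn
  · exact small n hn hnL
  · induction n, hLn using Nat.le_induction with
    | base => exact small L hn le_rfl
    | succ n hLn ih =>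
      have hn1 : 1 ≤ n := hN₁.trans ((le_max_right _ _).trans hLn)
      obtain ⟨h1, h2⟩ := h n ((le_max_right _ _).trans hLn)
      have h3 := hrec n ((le_max_left _ _).trans hLn)
      set δ : ℝ := ((n + 1 : ℕ) : ℝ) ^ (-ν)
      have hδ : 0 < δ := by positivity
      set M := T + 2 * C / b + 1 with hMdef
      have hCM : C ≤ M * (b / 2) := by
        have : 2 * C / b * (b / 2) = C := by field_simp
        rw [hMdef]
        nlinarith
      calc u (n + 1) ≤ (1 - b * δ) * u n + C * δ ^ (q + 1) := h3
        _ ≤ (1 - b * δ) * (M * ((n : ℝ) ^ (-ν)) ^ q) + M * (b / 2) * δ ^ (q + 1) := by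
          have : 0 ≤ 1 - b * δ := by linarith
          have := ih hn1
          gcongr
        _ = M * (((n : ℝ) ^ (-ν)) ^ q * (1 - b * δ)) + M * (b / 2) * δ ^ (q + 1) := by ring
        _ ≤ M * (δ ^ q * (1 - b / 2 * δ)) + M * (b / 2) * δ ^ (q + 1) := by gcongr
        _ = M * δ ^ q := by ring

end StochApprox

namespace StochApprox

/-! ### Scalar products on `ℝ^d` and consequences of coercivity. -/

section ScalarProduct

variable {d : ℕ} {B : LinearMap.BilinForm ℝ (Vec d)}

theorem IsScalarProduct.self_nonneg (hB : IsScalarProduct B) (v : Vec d) : 0 ≤ B v v := by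
  rcases eq_or_ne v 0 with rfl | h
  · simp
  · exact (hB.pos v h).le

theorem IsScalarProduct.sq_le (hB : IsScalarProduct B) (v w : Vec d) :
    B v w ^ 2 ≤ B v v * B w w :=
  LinearMap.BilinForm.apply_sq_le_of_symm B hB.self_nonneg ⟨fun x y => hB.symm x y⟩ v w

theorem IsScalarProduct.spNorm_sq (hB : IsScalarProduct B) (v : Vec d) :
    spNorm B v ^ 2 = B v v :=
  Real.sq_sqrt (hB.self_nonneg v)

theorem IsScalarProduct.spNorm_pow (hB : IsScalarProduct B) (v : Vec d) (r : ℕ) :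
    spNorm B v ^ (2 * r) = B v v ^ r := by
  rw [pow_mul, hB.spNorm_sq]

theorem IsScalarProduct.add_self (hB : IsScalarProduct B) (v w : Vec d) :
    B (v + w) (v + w) = B v v + 2 * B v w + B w w := by
  rw [map_add, map_add, LinearMap.add_apply, LinearMap.add_apply, hB.symm w v]
  ring

theorem IsScalarProduct.add_self_le (hB : IsScalarProduct B) (v w : Vec d) :
    B (v + w) (v + w) ≤ 2 * B v v + 2 * B w w := by
  have h1 := hB.add_self v w
  have h3 := hB.self_nonneg (v + -w)
  rw [hB.add_self] at h3
  simp only [map_neg, LinearMap.neg_apply, neg_neg] at h3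
  linarith

theorem IsScalarProduct.add_self_pow_le (hB : IsScalarProduct B) (v w : Vec d) (q : ℕ) :
    B (v + w) (v + w) ^ (q + 1) ≤ 4 ^ (q + 1) * (B v v ^ (q + 1) + B w w ^ (q + 1)) := by
  have hv := hB.self_nonneg v
  have hw := hB.self_nonneg w
  calc B (v + w) (v + w) ^ (q + 1) ≤ (2 * (B v v + B w w)) ^ (q + 1) := by
        have := hB.add_self_le v w
        exact pow_le_pow_left₀ (hB.self_nonneg _) (by linarith) _
    _ = 2 ^ (q + 1) * (B v v + B w w) ^ (q + 1) := mul_pow _ _ _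
    _ ≤ 2 ^ (q + 1) * (2 ^ q * (B v v ^ (q + 1) + B w w ^ (q + 1))) := by
        gcongr
        exact add_pow_le hv hw (q + 1)
    _ ≤ 2 ^ (q + 1) * (2 ^ (q + 1) * (B v v ^ (q + 1) + B w w ^ (q + 1))) := by
        gcongr <;> norm_num
    _ = _ := by
        rw [show (4 : ℝ) = 2 * 2 by norm_num, mul_pow]
        ring

theorem continuous_apply_self (B : LinearMap.BilinForm ℝ (Vec d)) :
    Continuous fun v : Vec d => B v v := by
  have : Continuous fun v : Vec d => LinearMap.toContinuousBilinearMap B v v := by fun_prop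
  exact this

/-- Compactness of the Euclidean unit sphere, which is empty when `d = 0`. It transfers
integrability from the given norm to the Euclidean one. -/
theorem IsScalarProduct.exists_le_apply_self (hB : IsScalarProduct B) :
    ∃ m : ℝ, 0 < m ∧ ∀ v : Vec d, m * ‖v‖ ^ 2 ≤ B v v := by
  rcases (Metric.sphere (0 : Vec d) 1).eq_empty_or_nonempty with hS | hS
  · refine ⟨1, one_pos, fun v => ?_⟩
    have hv : v = 0 := by
      by_contra hv
      have : ‖v‖⁻¹ • v ∈ Metric.sphere (0 : Vec d) 1 := by
        simp [norm_smul, norm_ne_zero_iff.2 hv]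
      simp [hS] at this
    simp [hv]
  · obtain ⟨u, hu, hmin⟩ := (isCompact_sphere (0 : Vec d) 1).exists_isMinOn hS
      (continuous_apply_self B).continuousOn
    have hu0 : u ≠ 0 := by
      rintro rfl
      simp at hu
    refine ⟨B u u, hB.pos u hu0, fun v => ?_⟩
    rcases eq_or_ne v 0 with rfl | hv
    · simp
    · have hn := norm_pos_iff.2 hv
      have h1 : B u u ≤ B (‖v‖⁻¹ • v) (‖v‖⁻¹ • v) :=
        hmin (by simp [norm_smul, hn.ne'])
      simp only [map_smul, LinearMap.smul_apply, smul_eq_mul] at h1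
      calc B u u * ‖v‖ ^ 2 ≤ ‖v‖⁻¹ * (‖v‖⁻¹ * B v v) * ‖v‖ ^ 2 := by gcongr
        _ = B v v := by field_simp

theorem Coercive.apply_le (hB : IsScalarProduct B) {c : ℝ} {ϑ : Vec d} {g : Vec d → Vec d}
    (hg : Coercive B c ϑ g) (θ : Vec d) :
    B (θ - ϑ) (g θ) ≤ -c * max (B (θ - ϑ) (θ - ϑ)) (B (g θ) (g θ)) := by
  simpa only [hB.spNorm_sq] using hg θ

theorem Coercive.setOf_eq_zero (hB : IsScalarProduct B) {c : ℝ} (hc : 0 < c) {ϑ : Vec d}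
    {g : Vec d → Vec d} (hg : Coercive B c ϑ g) : {θ | g θ = 0} = {ϑ} := by
  ext θ
  simp only [Set.mem_ofPred_eq, Set.mem_singleton_iff]
  have h := hg.apply_le hB θ
  constructor
  · intro h0
    by_contra hne
    have hpos := hB.pos (θ - ϑ) (sub_ne_zero.2 hne)
    have := mul_lt_mul_of_pos_left (lt_max_of_lt_left hpos : 0 < max _ (B (g θ) (g θ))) hc
    rw [h0] at h this
    simp only [map_zero] at h this
    linarith
  · rintro rfl
    by_contra hne
    have hpos := hB.pos (g θ) hne
    have := mul_lt_mul_of_pos_left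
      (lt_max_of_lt_right hpos : 0 < max (B (θ - θ) (θ - θ)) _) hc
    simp only [sub_self, map_zero, LinearMap.zero_apply] at h this
    linarith

/-- Coercivity and Cauchy–Schwarz give `c * ‖g θ‖² ≤ ‖θ - ϑ‖ * ‖g θ‖`. This linear growth controls
steps of arbitrary size. -/
theorem Coercive.apply_self_le (hB : IsScalarProduct B) {c : ℝ} (hc : 0 < c) {ϑ : Vec d}
    {g : Vec d → Vec d} (hg : Coercive B c ϑ g) (θ : Vec d) :
    B (g θ) (g θ) ≤ (c ^ 2)⁻¹ * B (θ - ϑ) (θ - ϑ) := by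
  have h := hg.apply_le hB θ
  have hsq := hB.sq_le (θ - ϑ) (g θ)
  set x := B (θ - ϑ) (θ - ϑ)
  set z := B (g θ) (g θ)
  have hz : 0 ≤ z := hB.self_nonneg _
  have h1 : c * z ≤ -B (θ - ϑ) (g θ) := by
    have := mul_le_mul_of_nonneg_left (le_max_right x z) hc.le
    linarith
  have h2 : (c * z) ^ 2 ≤ x * z := by
    calc (c * z) ^ 2 ≤ (-B (θ - ϑ) (g θ)) ^ 2 := pow_le_pow_left₀ (by positivity) h1 2
      _ ≤ x * z := by rw [neg_sq]; exact hsq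
  rw [inv_mul_eq_div, le_div_iff₀ (by positivity)]
  rcases hz.eq_or_lt with h0 | hpos
  · rw [← h0, zero_mul]
    exact hB.self_nonneg _
  · exact le_of_mul_le_mul_right (by linarith) hpos

/-- The maximum dominates the average, so twice the inner product is at most `-c * (‖θ - ϑ‖² + ‖g
θ‖²)`; for `γ ≤ c` the second half absorbs the quadratic term `γ ^ 2 * ‖g θ‖²`. -/
theorem Coercive.step_apply_self_le (hB : IsScalarProduct B) {c : ℝ} {ϑ : Vec d}
    {g : Vec d → Vec d} (hg : Coercive B c ϑ g) {γ : ℝ} (hγ : 0 < γ) (hγc : γ ≤ c) (θ : Vec d) :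
    B (θ - ϑ + γ • g θ) (θ - ϑ + γ • g θ) ≤ (1 - c * γ) * B (θ - ϑ) (θ - ϑ) := by
  have h := hg.apply_le hB θ
  rw [hB.add_self]
  simp only [map_smul, LinearMap.smul_apply, smul_eq_mul]
  set x := B (θ - ϑ) (θ - ϑ)
  set z := B (g θ) (g θ)
  have hz : 0 ≤ z := hB.self_nonneg _
  have hc : 0 ≤ c := hγ.le.trans hγc
  have h1 := mul_le_mul_of_nonneg_left (le_max_left x z) hc
  have h2 := mul_le_mul_of_nonneg_left (le_max_right x z) hc
  have h3 : 2 * B (θ - ϑ) (g θ) ≤ -(c * x) - c * z := by linarith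
  have h4 := mul_le_mul_of_nonneg_left h3 hγ.le
  have h5 : γ * (γ * z) ≤ γ * (c * z) := by gcongr
  linarith

end ScalarProduct

/-! ### Moments after one step from a deterministic point. -/

section OneStep

variable {d : ℕ} {B : LinearMap.BilinForm ℝ (Vec d)} {S : Type*} [MeasurableSpace S]
  {μ : Measure S}

theorem integrable_of_lintegral_pow_ne_top [IsFiniteMeasure μ] (hB : IsScalarProduct B) (q : ℕ)
    {D : S → Vec d} (hD : Measurable D)
    (h : ∫⁻ s, ENNReal.ofReal (B (D s) (D s) ^ (q + 1)) ∂μ ≠ ∞) :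
    Integrable (fun s => B (D s) (D s) ^ (q + 1)) μ ∧ Integrable D μ := by
  have hmeas : Measurable fun s => B (D s) (D s) ^ (q + 1) :=
    ((continuous_apply_self B).measurable.comp hD).pow_const _
  have h1 : Integrable (fun s => B (D s) (D s) ^ (q + 1)) μ :=
    (lintegral_ofReal_ne_top_iff_integrable hmeas.aestronglyMeasurable
      (Filter.Eventually.of_forall fun s => pow_nonneg (hB.self_nonneg _) _)).1 h
  refine ⟨h1, ?_⟩
  obtain ⟨m, hm, hle⟩ := hB.exists_le_apply_self
  refine ((integrable_const (1 : ℝ)).add (h1.const_mul ((m ^ (q + 1))⁻¹))).mono'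
    hD.aestronglyMeasurable (Filter.Eventually.of_forall fun s => ?_)
  simp only [Pi.add_apply]
  have h2 : m ^ (q + 1) * (‖D s‖ ^ 2) ^ (q + 1) ≤ B (D s) (D s) ^ (q + 1) := by
    rw [← mul_pow]
    exact pow_le_pow_left₀ (by positivity) (hle _) _
  have h3 : (‖D s‖ ^ 2) ^ (q + 1) ≤ (m ^ (q + 1))⁻¹ * B (D s) (D s) ^ (q + 1) := by
    rw [inv_mul_eq_div, le_div_iff₀ (by positivity)]
    linarith
  have h4 : ‖D s‖ ≤ 1 + (‖D s‖ ^ 2) ^ (q + 1) := by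
    rcases le_total ‖D s‖ 1 with h | h
    · have : 0 ≤ (‖D s‖ ^ 2) ^ (q + 1) := by positivity
      linarith
    · rw [← pow_mul]
      have := le_self_pow₀ h (n := 2 * (q + 1)) (by omega)
      linarith
  linarith

theorem integral_pow_le_of_lintegral_le (hB : IsScalarProduct B) (q : ℕ) {D : S → Vec d} {V : ℝ}
    (hV : 0 ≤ V) (hint : Integrable (fun s => B (D s) (D s) ^ (q + 1)) μ)
    (h : ∫⁻ s, ENNReal.ofReal (B (D s) (D s) ^ (q + 1)) ∂μ ≤ ENNReal.ofReal V) :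
    ∫ s, B (D s) (D s) ^ (q + 1) ∂μ ≤ V := by
  rw [← ofReal_integral_eq_lintegral_ofReal hint
    (Filter.Eventually.of_forall fun s => pow_nonneg (hB.self_nonneg _) _)] at h
  exact (ENNReal.ofReal_le_ofReal_iff hV).1 h

/-- Moments of a point perturbed by a centred random vector, for small step sizes. -/
theorem exists_lintegral_add_smul_le [IsProbabilityMeasure μ] (hB : IsScalarProduct B) (q : ℕ)
    {ε : ℝ} (hε : 0 < ε) :
    ∃ C : ℝ, 0 < C ∧ ∀ (γ V : ℝ) (a : Vec d) (D : S → Vec d), 0 < γ → γ ≤ 1 → 0 ≤ V →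
      Measurable D → ∫ s, D s ∂μ = 0 →
      ∫⁻ s, ENNReal.ofReal (B (D s) (D s) ^ (q + 1)) ∂μ ≤ ENNReal.ofReal V →
      ∫⁻ s, ENNReal.ofReal (B (a + γ • D s) (a + γ • D s) ^ (q + 1)) ∂μ ≤
        ENNReal.ofReal ((1 + ε * γ) * B a a ^ (q + 1) + C * γ ^ (q + 2) * V) := by
  obtain ⟨C, hC, h⟩ := exists_pow_expansion_bound_of_step q hε
  refine ⟨C, hC, fun γ V a D hγ hγ1 hV hD hD0 hDV => ?_⟩
  obtain ⟨hint, hintD⟩ := integrable_of_lintegral_pow_ne_top hB q hD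
    (ne_top_of_le_ne_top ENNReal.ofReal_ne_top hDV)
  have hVle := integral_pow_le_of_lintegral_le hB q hV hint hDV
  let L : Vec d →L[ℝ] ℝ := LinearMap.toContinuousLinearMap (B a)
  have hLint : Integrable (fun s => B a (D s)) μ := L.integrable_comp hintD
  -- Centredness removes the only term of the expansion that is linear in the noise.
  have hL0 : ∫ s, B a (D s) ∂μ = 0 := by
    have := L.integral_comp_comm hintD
    rw [hD0, map_zero] at this
    exact this
  have hpt : ∀ s, B (a + γ • D s) (a + γ • D s) ^ (q + 1) ≤
      ((1 + ε * γ) * B a a ^ (q + 1) + 2 * (q + 1) * B a a ^ q * γ * B a (D s)) +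
        C * γ ^ (q + 2) * B (D s) (D s) ^ (q + 1) := by
    intro s
    have := h γ (B a a) (B a (D s)) (B (D s) (D s)) hγ hγ1 (hB.self_nonneg _) (hB.self_nonneg _)
      (hB.sq_le _ _)
    convert this using 2
    rw [hB.add_self]
    simp only [map_smul, LinearMap.smul_apply, smul_eq_mul]
    ring
  have hi1 : Integrable (fun s => (1 + ε * γ) * B a a ^ (q + 1) +
      2 * (q + 1) * B a a ^ q * γ * B a (D s)) μ :=
    (integrable_const _).add (hLint.const_mul _)
  have hi2 : Integrable (fun s => C * γ ^ (q + 2) * B (D s) (D s) ^ (q + 1)) μ :=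
    hint.const_mul _
  refine (lintegral_mono fun s => ENNReal.ofReal_le_ofReal (hpt s)).trans ?_
  refine (ofReal_integral_eq_lintegral_ofReal (hi1.add hi2) (Filter.Eventually.of_forall fun s =>
    (pow_nonneg (hB.self_nonneg _) _).trans (hpt s))).symm.trans_le ?_
  refine ENNReal.ofReal_le_ofReal ?_
  rw [integral_add' hi1 hi2, integral_add (integrable_const _) (hLint.const_mul _),
    integral_const_mul (_ * γ), hL0]
  simp only [integral_const_mul, integral_const, probReal_univ, one_smul, mul_zero, add_zero]
  gcongr

/-- A crude convexity bound, needing neither centring nor a small step; it serves only to propagate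
finiteness. -/
theorem lintegral_add_smul_le [IsProbabilityMeasure μ] (hB : IsScalarProduct B) (q : ℕ)
    {γ V : ℝ} (hγ : 0 < γ) (hV : 0 ≤ V) (a : Vec d) {D : S → Vec d} (hD : Measurable D)
    (hDV : ∫⁻ s, ENNReal.ofReal (B (D s) (D s) ^ (q + 1)) ∂μ ≤ ENNReal.ofReal V) :
    ∫⁻ s, ENNReal.ofReal (B (a + γ • D s) (a + γ • D s) ^ (q + 1)) ∂μ ≤
      ENNReal.ofReal (4 ^ (q + 1) * (B a a ^ (q + 1) + (γ ^ 2) ^ (q + 1) * V)) := by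
  have ha := hB.self_nonneg a
  have hpt : ∀ s, ENNReal.ofReal (B (a + γ • D s) (a + γ • D s) ^ (q + 1)) ≤
      ENNReal.ofReal (4 ^ (q + 1) * B a a ^ (q + 1)) +
        ENNReal.ofReal (4 ^ (q + 1) * (γ ^ 2) ^ (q + 1)) *
          ENNReal.ofReal (B (D s) (D s) ^ (q + 1)) := by
    intro s
    have hs := hB.self_nonneg (D s)
    rw [← ENNReal.ofReal_mul (by positivity), ← ENNReal.ofReal_add (by positivity) (by positivity)]
    refine ENNReal.ofReal_le_ofReal ((hB.add_self_pow_le _ _ q).trans_eq ?_)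
    simp only [map_smul, LinearMap.smul_apply, smul_eq_mul]
    ring
  refine (lintegral_mono hpt).trans ?_
  have hmeas : Measurable fun s => ENNReal.ofReal (B (D s) (D s) ^ (q + 1)) :=
    (((continuous_apply_self B).measurable.comp hD).pow_const _).ennreal_ofReal
  rw [lintegral_add_left measurable_const, lintegral_const, measure_univ, mul_one,
    lintegral_const_mul _ hmeas]
  refine (add_le_add_right (mul_le_mul_right hDV _) _).trans ?_
  rw [← ENNReal.ofReal_mul (by positivity), ← ENNReal.ofReal_add (by positivity) (by positivity)]
  exact ENNReal.ofReal_le_ofReal (by linarith)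

variable [IsProbabilityMeasure μ] {c κ : ℝ} {ϑ : Vec d} {G : Vec d → S → Vec d}
  {g : Vec d → Vec d} {q : ℕ}

/-- The noise bound makes `G θ` integrable, so `g θ` is a genuine mean and not the default value `0`
of the Bochner integral. -/
theorem integral_sub_eq_zero_of_noise (hB : IsScalarProduct B) (hG : ∀ θ, Measurable (G θ))
    (hg : ∀ θ, g θ = ∫ s, G θ s ∂μ)
    (hV : ∀ θ, ∫⁻ s, ENNReal.ofReal (B (G θ s - g θ) (G θ s - g θ) ^ (q + 1)) ∂μ ≤
      ENNReal.ofReal (κ * (1 + B θ θ ^ (q + 1)))) (θ : Vec d) :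
    ∫ s, (G θ s - g θ) ∂μ = 0 := by
  have h1 := (integrable_of_lintegral_pow_ne_top hB q ((hG θ).sub_const (g θ))
    (ne_top_of_le_ne_top ENNReal.ofReal_ne_top (hV θ))).2
  have h2 : Integrable (G θ) μ := by
    have h2 := h1.add (integrable_const (g θ))
    have e : (fun s => G θ s - g θ) + (fun _ => g θ) = G θ := by
      ext s : 1
      simp
    rwa [e] at h2
  rw [integral_sub h2 (integrable_const _), ← hg θ]
  simp

theorem noise_bound_le (hB : IsScalarProduct B) (hκ : 0 < κ) (θ ϑ : Vec d) (q : ℕ) :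
    κ * (1 + B θ θ ^ (q + 1)) ≤ κ * 4 ^ (q + 1) * B (θ - ϑ) (θ - ϑ) ^ (q + 1) +
      κ * (1 + 4 ^ (q + 1) * B ϑ ϑ ^ (q + 1)) := by
  have h := hB.add_self_pow_le (θ - ϑ) ϑ q
  rw [sub_add_cancel] at h
  have := mul_le_mul_of_nonneg_left h hκ.le
  linarith

/-- One step of the scheme contracts the moment of the error when the step size is small. -/
theorem exists_lintegral_step_le_of_small (hB : IsScalarProduct B) (hc : 0 < c) (hκ : 0 < κ)
    (hG : ∀ θ, Measurable (G θ)) (hg : ∀ θ, g θ = ∫ s, G θ s ∂μ) (hgc : Coercive B c ϑ g)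
    (hV : ∀ θ, ∫⁻ s, ENNReal.ofReal (B (G θ s - g θ) (G θ s - g θ) ^ (q + 1)) ∂μ ≤
      ENNReal.ofReal (κ * (1 + B θ θ ^ (q + 1)))) :
    ∃ C η : ℝ, 0 < C ∧ 0 < η ∧ ∀ γ : ℝ, 0 < γ → γ ≤ η → c * γ ≤ 1 ∧ ∀ θ,
      ∫⁻ s, ENNReal.ofReal (B (θ + γ • G θ s - ϑ) (θ + γ • G θ s - ϑ) ^ (q + 1)) ∂μ ≤
        ENNReal.ofReal ((1 - c / 2 * γ) * B (θ - ϑ) (θ - ϑ) ^ (q + 1) + C * γ ^ (q + 2)) := by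
  -- Of the contraction rate `c`, one quarter goes to the Young term and one quarter to the part of
  -- the noise growing with `θ - ϑ`; `c / 2` remains.
  obtain ⟨C, hC, h⟩ := exists_lintegral_add_smul_le (μ := μ) hB q (show 0 < c / 4 by positivity)
  have hϑ := hB.self_nonneg ϑ
  set C₁ := C * κ * 4 ^ (q + 1) with hC₁
  have hC₁pos : 0 < C₁ := by positivity
  set C₂ := C * (κ * (1 + 4 ^ (q + 1) * B ϑ ϑ ^ (q + 1))) with hC₂
  have hC₂pos : 0 < C₂ := by positivity
  -- The four bounds on `γ` serve, in order, the expansion, the drift contraction, the sign of `1 -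
  -- c * γ`, and the absorption of the growing noise.
  refine ⟨C₂, min (min 1 c) (min (1 / c) (c / 4 / C₁)), hC₂pos, by positivity,
    fun γ hγ hγη => ?_⟩
  simp only [le_min_iff] at hγη
  obtain ⟨⟨hγ1, hγc⟩, hγc', hγC⟩ := hγη
  have hcγ : c * γ ≤ 1 := by
    rw [le_div_iff₀ hc] at hγc'
    linarith
  refine ⟨hcγ, fun θ => ?_⟩
  have hθ := hB.self_nonneg θ
  have hx := hB.self_nonneg (θ - ϑ)
  have h1 := h γ (κ * (1 + B θ θ ^ (q + 1))) (θ - ϑ + γ • g θ) (fun s => G θ s - g θ) hγ hγ1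
    (by positivity) ((hG θ).sub_const _) (integral_sub_eq_zero_of_noise hB hG hg hV θ) (hV θ)
  have e : ∀ s, θ - ϑ + γ • g θ + γ • (G θ s - g θ) = θ + γ • G θ s - ϑ := fun s => by
    rw [smul_sub]; abel
  simp only [e] at h1
  refine h1.trans (ENNReal.ofReal_le_ofReal ?_)
  have h2 := hgc.step_apply_self_le hB hγ hγc θ
  set x := B (θ - ϑ) (θ - ϑ)
  have h0 : 0 ≤ 1 - c * γ := by linarith
  have h3 : B (θ - ϑ + γ • g θ) (θ - ϑ + γ • g θ) ^ (q + 1) ≤ (1 - c * γ) * x ^ (q + 1) := by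
    calc _ ≤ ((1 - c * γ) * x) ^ (q + 1) := pow_le_pow_left₀ (hB.self_nonneg _) h2 _
      _ = (1 - c * γ) ^ (q + 1) * x ^ (q + 1) := mul_pow _ _ _
      _ ≤ (1 - c * γ) * x ^ (q + 1) := by
        gcongr
        exact pow_le_of_le_one h0 (by nlinarith) (by omega)
  have h4 : C * γ ^ (q + 2) * (κ * (1 + B θ θ ^ (q + 1))) ≤
      C₁ * γ ^ (q + 2) * x ^ (q + 1) + C₂ * γ ^ (q + 2) := by
    calc _ ≤ C * γ ^ (q + 2) * (κ * 4 ^ (q + 1) * x ^ (q + 1) +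
          κ * (1 + 4 ^ (q + 1) * B ϑ ϑ ^ (q + 1))) := by
          gcongr
          exact noise_bound_le hB hκ θ ϑ q
      _ = _ := by rw [hC₁, hC₂]; ring
  have h5 : C₁ * γ ^ (q + 2) ≤ c / 4 * γ := by
    rw [le_div_iff₀ hC₁pos] at hγC
    calc C₁ * γ ^ (q + 2) = γ * C₁ * γ * γ ^ q := by ring
      _ ≤ c / 4 * γ * 1 := by
        gcongr
        exact pow_le_one₀ hγ.le hγ1
      _ = _ := mul_one _
  have h6 : C₁ * γ ^ (q + 2) * x ^ (q + 1) ≤ c / 4 * γ * x ^ (q + 1) := by gcongr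
  have h7 : (1 + c / 4 * γ) * B (θ - ϑ + γ • g θ) (θ - ϑ + γ • g θ) ^ (q + 1) ≤
      (1 - 3 / 4 * (c * γ)) * x ^ (q + 1) := by
    calc _ ≤ (1 + c / 4 * γ) * ((1 - c * γ) * x ^ (q + 1)) := by gcongr
      _ = ((1 + c / 4 * γ) * (1 - c * γ)) * x ^ (q + 1) := by ring
      _ ≤ _ := by
        gcongr
        nlinarith [sq_nonneg (c * γ)]
  linarith

/-- One step of the scheme preserves the finiteness of the moment of the error. -/
theorem exists_lintegral_step_le (hB : IsScalarProduct B) (hc : 0 < c) (hκ : 0 < κ)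
    (hG : ∀ θ, Measurable (G θ)) (hgc : Coercive B c ϑ g)
    (hV : ∀ θ, ∫⁻ s, ENNReal.ofReal (B (G θ s - g θ) (G θ s - g θ) ^ (q + 1)) ∂μ ≤
      ENNReal.ofReal (κ * (1 + B θ θ ^ (q + 1)))) {γ : ℝ} (hγ : 0 < γ) :
    ∃ A C : ℝ, 0 ≤ A ∧ 0 ≤ C ∧ ∀ θ,
      ∫⁻ s, ENNReal.ofReal (B (θ + γ • G θ s - ϑ) (θ + γ • G θ s - ϑ) ^ (q + 1)) ∂μ ≤
        ENNReal.ofReal (A * B (θ - ϑ) (θ - ϑ) ^ (q + 1) + C) := by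
  have hϑ := hB.self_nonneg ϑ
  refine ⟨4 ^ (q + 1) * ((2 + 2 * γ ^ 2 * (c ^ 2)⁻¹) ^ (q + 1) +
    (γ ^ 2) ^ (q + 1) * (κ * 4 ^ (q + 1))),
    4 ^ (q + 1) * ((γ ^ 2) ^ (q + 1) * (κ * (1 + 4 ^ (q + 1) * B ϑ ϑ ^ (q + 1)))),
    by positivity, by positivity, fun θ => ?_⟩
  have hθ := hB.self_nonneg θ
  have hx := hB.self_nonneg (θ - ϑ)
  have h1 := lintegral_add_smul_le hB q hγ (by positivity) (θ - ϑ + γ • g θ)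
    ((hG θ).sub_const (g θ)) (hV θ)
  have e : ∀ s, θ - ϑ + γ • g θ + γ • (G θ s - g θ) = θ + γ • G θ s - ϑ := fun s => by
    rw [smul_sub]; abel
  simp only [e] at h1
  refine h1.trans (ENNReal.ofReal_le_ofReal ?_)
  have h2 : B (θ - ϑ + γ • g θ) (θ - ϑ + γ • g θ) ≤
      (2 + 2 * γ ^ 2 * (c ^ 2)⁻¹) * B (θ - ϑ) (θ - ϑ) := by
    have h3 := hB.add_self_le (θ - ϑ) (γ • g θ)
    simp only [map_smul, LinearMap.smul_apply, smul_eq_mul] at h3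
    have h4 := mul_le_mul_of_nonneg_left (hgc.apply_self_le hB hc θ) (sq_nonneg γ)
    simp only [map_add, map_smul, LinearMap.add_apply, LinearMap.smul_apply, smul_eq_mul] at h3 ⊢
    linarith
  have h3 := pow_le_pow_left₀ (hB.self_nonneg _) h2 (q + 1)
  rw [mul_pow] at h3
  have h4 := mul_le_mul_of_nonneg_left (noise_bound_le hB hκ θ ϑ q)
    (show 0 ≤ (γ ^ 2) ^ (q + 1) by positivity)
  have h5 := mul_le_mul_of_nonneg_left (add_le_add h3 h4) (show (0 : ℝ) ≤ 4 ^ (q + 1) by positivity)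
  refine h5.trans_eq ?_
  ring

end OneStep

end StochApprox

namespace StochApprox

/-! ### Joint measurability of the gradient field. -/

section Gradient

variable {d : ℕ} {S : Type*} [MeasurableSpace S] {F : Vec d → S → ℝ}

/-- Directional derivatives are pointwise limits of jointly measurable difference quotients, and the
coordinates of the gradient are directional derivatives along the standard basis. -/
theorem measurable_gradTheta (hF : Measurable fun r : Vec d × S => F r.1 r.2)
    (hd : ∀ x, ContDiff ℝ 1 fun θ => F θ x) :
    Measurable fun r : Vec d × S => gradTheta F r.1 r.2 := by
  have key : ∀ v : Vec d, Measurable fun r : Vec d × S => fderiv ℝ (fun η => F η r.2) r.1 v := by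
    intro v
    refine measurable_of_tendsto_metrizable
      (f := fun (n : ℕ) (r : Vec d × S) => (n : ℝ) • (F (r.1 + (n : ℝ)⁻¹ • v) r.2 - F r.1 r.2))
      (fun n => ?_) ?_
    · have : Measurable fun r : Vec d × S => F (r.1 + (n : ℝ)⁻¹ • v) r.2 :=
        hF.comp ((measurable_fst.add_const _).prodMk measurable_snd)
      exact (this.sub hF).const_mul _
    · rw [tendsto_pi_nhds]
      intro r
      have h := (((hd r.2).differentiable one_ne_zero) r.1).hasFDerivAt
      exact (h.lim_real v).comp tendsto_natCast_atTop_atTop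
  have hcoord : ∀ i : Fin d, Measurable fun r : Vec d × S => gradTheta F r.1 r.2 i := by
    intro i
    convert key (EuclideanSpace.single i 1) using 2 with r
    rw [← inner_gradient_left, EuclideanSpace.inner_single_right]
    simp only [gradTheta, one_mul, conj_trivial]
  exact (WithLp.measurable_toLp 2 (Fin d → ℝ)).comp (measurable_pi_lambda _ hcoord)

end Gradient

/-! ### The iterates: independence, moment recursion and rate. -/

section Scheme

variable {d : ℕ} {Ω S : Type*} {X : ℕ → Ω → S} {α ν : ℝ} {ξ ϑ : Vec d} {G : Vec d → S → Vec d}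
  {Θ : ℕ → Ω → Vec d} {B : LinearMap.BilinForm ℝ (Vec d)}

theorem IsStochApprox.succ (hΘ : IsStochApprox α ν ξ G X Θ) (n : ℕ) (ω : Ω) :
    Θ (n + 1) ω = Θ n ω + (α * ((n + 1 : ℕ) : ℝ) ^ (-ν)) • G (Θ n ω) (X (n + 1) ω) := by
  rw [(hΘ ω).2 (n + 1) (Nat.le_add_left _ _), Nat.add_sub_cancel,
    Real.rpow_neg (Nat.cast_nonneg _), div_eq_mul_inv]

variable [MeasurableSpace S]

/-- The iterate `Θ n` is a measurable function of the data `X 1, …, X n`. -/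
theorem IsStochApprox.exists_measurable_eq (hΘ : IsStochApprox α ν ξ G X Θ)
    (hG : Measurable fun r : Vec d × S => G r.1 r.2) (n : ℕ) :
    ∃ φ : (Finset.range n → S) → Vec d, Measurable φ ∧
      ∀ ω, Θ n ω = φ fun i => X ((i : ℕ) + 1) ω := by
  induction n with
  | zero => exact ⟨fun _ => ξ, measurable_const, fun ω => (hΘ ω).1⟩
  | succ n ih =>
    obtain ⟨φ, hφ, h⟩ := ih
    let r : (Finset.range (n + 1) → S) → (Finset.range n → S) := fun t i =>
      t ⟨i, Finset.mem_range.2 ((Finset.mem_range.1 i.2).trans (Nat.lt_succ_self n))⟩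
    have hr : Measurable r := measurable_pi_lambda _ fun i => measurable_pi_apply _
    refine ⟨fun t => φ (r t) + (α * ((n + 1 : ℕ) : ℝ) ^ (-ν)) •
      G (φ (r t)) (t ⟨n, Finset.self_mem_range_succ n⟩), ?_, fun ω => ?_⟩
    · have h1 : Measurable fun t => φ (r t) := hφ.comp hr
      exact h1.add ((hG.comp (h1.prodMk (measurable_pi_apply _))).fun_const_smul _)
    · rw [hΘ.succ, h ω]

variable [MeasurableSpace Ω] {P : Measure Ω}

theorem IsStochApprox.measurable (hΘ : IsStochApprox α ν ξ G X Θ) (hX : IsIID P X)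
    (hG : Measurable fun r : Vec d × S => G r.1 r.2) (n : ℕ) : Measurable (Θ n) := by
  obtain ⟨φ, hφ, h⟩ := hΘ.exists_measurable_eq hG n
  rw [funext h]
  exact hφ.comp (measurable_pi_lambda _ fun i => hX.measurable i)

theorem IsStochApprox.indepFun (hΘ : IsStochApprox α ν ξ G X Θ) (hX : IsIID P X)
    (hG : Measurable fun r : Vec d × S => G r.1 r.2) (n : ℕ) :
    IndepFun (Θ n) (X (n + 1)) P := by
  obtain ⟨φ, hφ, h⟩ := hΘ.exists_measurable_eq hG n
  -- Index `i` of the family stands for `X (i + 1)`, so `range n` carries `X 1, …, X n` and `{n}`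
  -- carries `X (n + 1)`.
  have h1 := hX.indep.indepFun_finset (Finset.range n) {n} (by simp) hX.measurable
  have h2 := h1.comp hφ (measurable_pi_apply (⟨n, Finset.mem_singleton_self n⟩ : ({n} : Finset ℕ)))
  rw [funext h]
  exact h2

variable [IsProbabilityMeasure P]

theorem IsStochApprox.map_prod (hΘ : IsStochApprox α ν ξ G X Θ) (hX : IsIID P X)
    (hG : Measurable fun r : Vec d × S => G r.1 r.2) (n : ℕ) :
    P.map (fun ω => (Θ n ω, X (n + 1) ω)) = (P.map (Θ n)).prod (P.map (X 1)) := by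
  rw [(indepFun_iff_map_prod_eq_prod_map_map (hΘ.measurable hX hG n).aemeasurable
    (hX.measurable n).aemeasurable).1 (hΘ.indepFun hX hG n), (hX.identDistrib n).map_eq]

/-- A bound on one step from every fixed point passes to the moments of the scheme. -/
theorem IsStochApprox.lintegral_succ_le (hΘ : IsStochApprox α ν ξ G X Θ) (hX : IsIID P X)
    (hG : Measurable fun r : Vec d × S => G r.1 r.2) {q : ℕ} (n : ℕ) {A C : ℝ}
    (hB : IsScalarProduct B) (hA : 0 ≤ A) (hC : 0 ≤ C)
    (h : ∀ θ, ∫⁻ s, ENNReal.ofReal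
      (B (θ + (α * ((n + 1 : ℕ) : ℝ) ^ (-ν)) • G θ s - ϑ)
        (θ + (α * ((n + 1 : ℕ) : ℝ) ^ (-ν)) • G θ s - ϑ) ^ (q + 1)) ∂(P.map (X 1)) ≤
        ENNReal.ofReal (A * B (θ - ϑ) (θ - ϑ) ^ (q + 1) + C)) :
    ∫⁻ ω, ENNReal.ofReal (B (Θ (n + 1) ω - ϑ) (Θ (n + 1) ω - ϑ) ^ (q + 1)) ∂P ≤
      ENNReal.ofReal A * ∫⁻ ω, ENNReal.ofReal (B (Θ n ω - ϑ) (Θ n ω - ϑ) ^ (q + 1)) ∂P +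
        ENNReal.ofReal C := by
  have hΘm := hΘ.measurable hX hG n
  have hXm : Measurable (X (n + 1)) := hX.measurable n
  have : IsProbabilityMeasure (P.map (Θ n)) := Measure.isProbabilityMeasure_map hΘm.aemeasurable
  have : IsProbabilityMeasure (P.map (X 1)) :=
    Measure.isProbabilityMeasure_map (hX.measurable 0).aemeasurable
  have hM : Measurable fun v : Vec d => ENNReal.ofReal (B (v - ϑ) (v - ϑ) ^ (q + 1)) :=
    (((continuous_apply_self B).measurable.comp
      (measurable_id.sub_const ϑ)).pow_const _).ennreal_ofReal
  have hstep : Measurable fun r : Vec d × S =>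
      r.1 + (α * ((n + 1 : ℕ) : ℝ) ^ (-ν)) • G r.1 r.2 :=
    measurable_fst.add (hG.fun_const_smul _)
  calc ∫⁻ ω, ENNReal.ofReal (B (Θ (n + 1) ω - ϑ) (Θ (n + 1) ω - ϑ) ^ (q + 1)) ∂P
      = ∫⁻ r, ENNReal.ofReal (B (r.1 + (α * ((n + 1 : ℕ) : ℝ) ^ (-ν)) • G r.1 r.2 - ϑ)
          (r.1 + (α * ((n + 1 : ℕ) : ℝ) ^ (-ν)) • G r.1 r.2 - ϑ) ^ (q + 1))
          ∂(P.map fun ω => (Θ n ω, X (n + 1) ω)) := by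
        simp only [hΘ.succ]
        exact (lintegral_map (hM.comp hstep) (hΘm.prodMk hXm)).symm
    _ = ∫⁻ θ, ∫⁻ s, ENNReal.ofReal (B (θ + (α * ((n + 1 : ℕ) : ℝ) ^ (-ν)) • G θ s - ϑ)
          (θ + (α * ((n + 1 : ℕ) : ℝ) ^ (-ν)) • G θ s - ϑ) ^ (q + 1))
          ∂(P.map (X 1)) ∂(P.map (Θ n)) := by
        -- Tonelli on the product law plays the role of conditioning on the past.
        rw [hΘ.map_prod hX hG n]
        exact lintegral_prod _ (hM.comp hstep).aemeasurable
    _ ≤ ∫⁻ θ, (ENNReal.ofReal A * ENNReal.ofReal (B (θ - ϑ) (θ - ϑ) ^ (q + 1)) +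
          ENNReal.ofReal C) ∂(P.map (Θ n)) := by
        refine lintegral_mono fun θ => (h θ).trans_eq ?_
        have := pow_nonneg (hB.self_nonneg (θ - ϑ)) (q + 1)
        rw [← ENNReal.ofReal_mul hA, ← ENNReal.ofReal_add (by positivity) hC]
    _ = _ := by
        rw [lintegral_add_right _ measurable_const, lintegral_const, measure_univ, mul_one,
          lintegral_const_mul _ hM, lintegral_map hM hΘm]

theorem hasStrongRate_of_coercive {κ c : ℝ} (hα : 0 < α) (hκ : 0 < κ) (hc : 0 < c)
    (hν0 : 0 < ν) (hν1 : ν < 1) (hB : IsScalarProduct B) (hX : IsIID P X) {q : ℕ}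
    {g : Vec d → Vec d} (hG : Measurable fun r : Vec d × S => G r.1 r.2)
    (hV : NoiseBound P B (2 * (q + 1)) κ G (X 1) g) (hg : ∀ θ, g θ = ∫ ω, G θ (X 1 ω) ∂P)
    (hgc : Coercive B c ϑ g) (hΘ : IsStochApprox α ν ξ G X Θ) :
    HasStrongRate P B (2 * (q + 1)) ν ϑ Θ := by
  have hX1 : Measurable (X 1) := hX.measurable 0
  have : IsProbabilityMeasure (P.map (X 1)) := Measure.isProbabilityMeasure_map hX1.aemeasurable
  have hGθ : ∀ θ, Measurable (G θ) := fun θ => hG.comp (measurable_const.prodMk measurable_id)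
  have hg' : ∀ θ, g θ = ∫ s, G θ s ∂(P.map (X 1)) := fun θ => by
    rw [integral_map hX1.aemeasurable (hGθ θ).aestronglyMeasurable, hg θ]
  have hV' : ∀ θ, ∫⁻ s, ENNReal.ofReal (B (G θ s - g θ) (G θ s - g θ) ^ (q + 1)) ∂(P.map (X 1)) ≤
      ENNReal.ofReal (κ * (1 + B θ θ ^ (q + 1))) := fun θ => by
    have hM : Measurable fun s => ENNReal.ofReal (B (G θ s - g θ) (G θ s - g θ) ^ (q + 1)) :=
      (((continuous_apply_self B).measurable.comp
        ((hGθ θ).sub_const (g θ))).pow_const _).ennreal_ofReal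
    rw [lintegral_map hM hX1]
    simpa only [expectNN, hB.spNorm_pow] using hV θ
  set U : ℕ → ℝ≥0∞ := fun n =>
    ∫⁻ ω, ENNReal.ofReal (B (Θ n ω - ϑ) (Θ n ω - ϑ) ^ (q + 1)) ∂P with hU
  have hγpos : ∀ n : ℕ, 0 < α * ((n + 1 : ℕ) : ℝ) ^ (-ν) := fun n => by positivity
  -- Finiteness must precede the passage to real numbers, as `toReal` sends `∞` to `0`.
  have hfin : ∀ n, U n ≠ ∞ := by
    intro n
    induction n with
    | zero =>
      simp only [hU, fun ω => (hΘ ω).1, lintegral_const, measure_univ, mul_one]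
      exact ENNReal.ofReal_ne_top
    | succ n ih =>
      obtain ⟨A, C, hA, hC, h⟩ := exists_lintegral_step_le hB hc hκ hGθ hgc hV' (hγpos n)
      refine ne_top_of_le_ne_top ?_ (hΘ.lintegral_succ_le hX hG n hB hA hC h)
      exact ENNReal.add_ne_top.2
        ⟨ENNReal.mul_ne_top ENNReal.ofReal_ne_top ih, ENNReal.ofReal_ne_top⟩
  obtain ⟨C, η, hC, hη, h⟩ := exists_lintegral_step_le_of_small hB hc hκ hGθ hg' hgc hV'
  have hδ : Filter.Tendsto (fun n : ℕ => α * ((n + 1 : ℕ) : ℝ) ^ (-ν)) Filter.atTop (nhds 0) := by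
    have h1 := ((tendsto_rpow_neg_atTop hν0).comp tendsto_natCast_atTop_atTop).comp
      (Filter.tendsto_add_atTop_nat 1)
    simpa using h1.const_mul α
  obtain ⟨N, hN⟩ := Filter.eventually_atTop.1 (hδ.eventually_le_const hη)
  -- With power `q + 1`, the source term has exponent `q + 2`; the factors of `α` in `γ` move into
  -- the constants.
  obtain ⟨M, hM, hrate⟩ := exists_rate_of_recursion (q + 1) hν0 hν1
    (show 0 < c / 2 * α by positivity) (show 0 ≤ C * α ^ (q + 2) by positivity)
    (u := fun n => (U n).toReal) (fun n => ENNReal.toReal_nonneg) (N := N) (by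
      intro n hn
      obtain ⟨hcγ, hstep⟩ := h _ (hγpos n) (hN n hn)
      have hγ := hγpos n
      set γ := α * ((n + 1 : ℕ) : ℝ) ^ (-ν) with hγdef
      have hA : 0 ≤ 1 - c / 2 * γ := by linarith
      have hC' : 0 ≤ C * γ ^ (q + 2) := by positivity
      have h1 := hΘ.lintegral_succ_le hX hG n hB hA hC' hstep
      have h2 := ENNReal.toReal_mono (ENNReal.add_ne_top.2
        ⟨ENNReal.mul_ne_top ENNReal.ofReal_ne_top (hfin n), ENNReal.ofReal_ne_top⟩) h1
      rw [ENNReal.toReal_add (ENNReal.mul_ne_top ENNReal.ofReal_ne_top (hfin n))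
        ENNReal.ofReal_ne_top, ENNReal.toReal_mul, ENNReal.toReal_ofReal hA,
        ENNReal.toReal_ofReal hC'] at h2
      refine h2.trans_eq ?_
      rw [hγdef, mul_pow]
      ring)
  refine ⟨M ^ (1 / ((2 * (q + 1) : ℕ) : ℝ)), by positivity, fun n hn => ?_⟩
  have hn0 : (0 : ℝ) < n := by exact_mod_cast hn
  have hr : (0 : ℝ) ≤ 1 / ((2 * (q + 1) : ℕ) : ℝ) := by positivity
  simp only [expectNN, hB.spNorm_pow]
  have h1 : U n ≤ ENNReal.ofReal (M * ((n : ℝ) ^ (-ν)) ^ (q + 1)) := by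
    rw [← ENNReal.ofReal_toReal (hfin n)]
    exact ENNReal.ofReal_le_ofReal (hrate n hn)
  refine (ENNReal.rpow_le_rpow h1 hr).trans_eq ?_
  rw [ENNReal.ofReal_rpow_of_nonneg (by positivity) hr, Real.mul_rpow hM.le (by positivity),
    ← Real.rpow_natCast ((n : ℝ) ^ (-ν)), ← Real.rpow_mul hn0.le, ← Real.rpow_mul hn0.le]
  congr 3
  push_cast
  field_simp

end Scheme

end StochApprox
-- The main theorem.
theorem mainTheorem6
    (d : ℕ) (hd : 1 ≤ d) (p : ℕ) (hp : 2 ≤ p) (hpe : Even p)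
    (α κ c : ℝ) (hα : 0 < α) (hκ : 0 < κ) (hc : 0 < c) (ν : ℝ) (hν0 : 0 < ν) (hν1 : ν < 1)
    (ξ ϑ : StochApprox.Vec d)
    (B : LinearMap.BilinForm ℝ (StochApprox.Vec d)) (hB : StochApprox.IsScalarProduct B)
    {Ω : Type*} [MeasurableSpace Ω] (P : Measure Ω) [IsProbabilityMeasure P]
    {S : Type*} [MeasurableSpace S]
    (X : ℕ → Ω → S) (hX : StochApprox.IsIID P X) :
    -- stochastic approximation with a general field `G`
    (∀ (G : StochApprox.Vec d → S → StochApprox.Vec d)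
        (g : StochApprox.Vec d → StochApprox.Vec d) (Θ : ℕ → Ω → StochApprox.Vec d),
      Measurable (fun q : StochApprox.Vec d × S => G q.1 q.2) →
      StochApprox.NoiseBound P B p κ G (X 1) g →
      (∀ θ, g θ = ∫ ω, G θ (X 1 ω) ∂P) →
      StochApprox.Coercive B c ϑ g →
      StochApprox.IsStochApprox α ν ξ G X Θ →
      {θ : StochApprox.Vec d | g θ = 0} = {ϑ} ∧ StochApprox.HasStrongRate P B p ν ϑ Θ) ∧
    -- stochastic approximation with a gradient field `∇_θ F` and its mean `g`
    (∀ (F : StochApprox.Vec d → S → ℝ)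
        (g : StochApprox.Vec d → StochApprox.Vec d) (Θ : ℕ → Ω → StochApprox.Vec d),
      Measurable (fun q : StochApprox.Vec d × S => F q.1 q.2) →
      (∀ x, ContDiff ℝ 1 (fun θ => F θ x)) →
      StochApprox.NoiseBound P B p κ (StochApprox.gradTheta F) (X 1) g →
      StochApprox.Coercive B c ϑ g →
      (∀ θ, g θ = ∫ ω, StochApprox.gradTheta F θ (X 1 ω) ∂P) →
      StochApprox.IsStochApprox α ν ξ (StochApprox.gradTheta F) X Θ →
      {θ : StochApprox.Vec d | g θ = 0} = {ϑ} ∧ StochApprox.HasStrongRate P B p ν ϑ Θ) ∧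
    -- the same with the mean gradient written out and its integrability assumed
    (∀ (F : StochApprox.Vec d → S → ℝ) (Θ : ℕ → Ω → StochApprox.Vec d),
      Measurable (fun q : StochApprox.Vec d × S => F q.1 q.2) →
      (∀ x, ContDiff ℝ 1 (fun θ => F θ x)) →
      (∀ θ, StochApprox.expectNN P
        (fun ω => StochApprox.spNorm B (StochApprox.gradTheta F θ (X 1 ω))) < ⊤) →
      StochApprox.Coercive B c ϑ (fun θ => ∫ ω, StochApprox.gradTheta F θ (X 1 ω) ∂P) →
      StochApprox.NoiseBound P B p κ (StochApprox.gradTheta F) (X 1)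
        (fun θ => ∫ ω, StochApprox.gradTheta F θ (X 1 ω) ∂P) →
      StochApprox.IsStochApprox α ν ξ (StochApprox.gradTheta F) X Θ →
      {θ : StochApprox.Vec d | ∫ ω, StochApprox.gradTheta F θ (X 1 ω) ∂P = 0} = {ϑ} ∧
        StochApprox.HasStrongRate P B p ν ϑ Θ) := by
  -- Evenness makes `‖v‖ ^ p` the polynomial `B v v ^ (q + 1)`, free of square roots.
  obtain ⟨q, rfl⟩ : ∃ q, p = 2 * (q + 1) := by
    obtain ⟨r, rfl⟩ := hpe
    exact ⟨r - 1, by omega⟩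
  refine ⟨fun G g Θ hG hV hg hgc hΘ => ?_, fun F g Θ hF hFd hV hgc hg hΘ => ?_,
    fun F Θ hF hFd _ hgc hV hΘ => ?_⟩
  · exact ⟨hgc.setOf_eq_zero hB hc,
      StochApprox.hasStrongRate_of_coercive hα hκ hc hν0 hν1 hB hX hG hV hg hgc hΘ⟩
  · exact ⟨hgc.setOf_eq_zero hB hc, StochApprox.hasStrongRate_of_coercive hα hκ hc hν0 hν1 hB hX
      (StochApprox.measurable_gradTheta hF hFd) hV hg hgc hΘ⟩
  · exact ⟨hgc.setOf_eq_zero hB hc, StochApprox.hasStrongRate_of_coercive hα hκ hc hν0 hν1 hB hX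
      (StochApprox.measurable_gradTheta hF hFd) hV (fun _ => rfl) hgc hΘ⟩
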